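/- Let $p>1$ and let $\gamma,r:[0,\infty)\to(0,\infty)$ be measurable, with $\gamma$ locally integrable and $\sup_{t\ge 0} r(t)<\infty$, such that $\liminf_{t\to\infty} r(t)/\gamma(t)>1$. Consider the deterministic Mackey–Glass equation $$x'(t)=-\gamma(t)x(t)+r(t)\frac{x(t-1)}{1+x(t-1)^p},\qquad t\ge 0, \tag{$*$}$$ understood as an integral equation: a (global) solution is a function $x$ on $[-1,\infty)$ for which the right-hand side is locally integrable on $[0,\infty)$ and $x(t)=x(0)+\int_0^t\big[-\gamma(s)x(s)+r(s)\tfrac{x(s-1)}{1+x(s-1)^p}\big]ds$ for all $t\ge 0$. (1) For every càdlàg (in particular, every continuous) $\varphi:[-1,0]\to\mathbb R$ with $\inf_{[-1,0]}\varphi>0$ there is exactly one global solution $x$ with $x=\varphi$ on $[-1,0]$, and it satisfies $\inf_{t\ge 0}x(t)>0$. (2) If in addition $\gamma$ and $r$ are constant, then $r>\gamma$ and $(*)$ admits a non-trivial invariant measure $\nu$ on $C[-1,0]$, and hence a stationary distribution $\mu$ with $\mu([m,M])=1$ for some $m,M>0$, where $\mu$ is the push-forward of $\nu$ under $\varphi\mapsto\varphi(0)$.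 Here a Borel probability measure $\nu$ on $C[-1,0]$ (with the supremum norm) that is concentrated on the non-negative functions is called an *invariant measure* of $(*)$ if a global solution exists from $\nu$-almost every initial function and, for every random global solution $X$ whose initial segment $(X(\theta))_{\theta\in[-1,0]}$ has law $\nu$, the segment $X_t=(X(t+\theta))_{\theta\in[-1,0]}$ has law $\nu$ for all $t\ge 0$. It is *non-trivial* if $\nu\ne\delta_0$, the Dirac measure at the zero function. A probability measure $\mu$ on $\mathbb R$ is a *stationary distribution* of $(*)$ if there is a random global solution $X$ with a non-negative initial segment in $C[-1,0]$ such that $X(t)$ has law $\mu$ for all $t\ge 0$. -/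

import Mathlib

open MeasureTheory ProbabilityTheory Filter Topology Set

/-- `φ`, restricted to `[-1, 0]`, is càdlàg: right-continuous with left limits. Only the values of
`φ` on `[-1, 0]` matter. -/
def IsCadlagHistory (φ : ℝ → ℝ) : Prop :=
  (∀ t ∈ Ico (-1 : ℝ) 0, Tendsto φ (𝓝[>] t) (𝓝 (φ t))) ∧
    ∀ t ∈ Ioc (-1 : ℝ) 0, ∃ l : ℝ, Tendsto φ (𝓝[<] t) (𝓝 l)

/-- The right-hand side `-γ(s) x(s) + r(s) x(s-1) / (1 + x(s-1)^p)` along a path `x`. -/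
noncomputable def mackeyGlassRHS (γ r : ℝ → ℝ) (p : ℝ) (x : ℝ → ℝ) (s : ℝ) : ℝ :=
  -γ s * x s + r s * (x (s - 1) / (1 + x (s - 1) ^ p))

/-- `x : [-1, ∞) → ℝ` is a global solution (in the sense of Carathéodory) of
`x'(t) = -γ(t) x(t) + r(t) x(t-1) / (1 + x(t-1)^p)`, `t ≥ 0`: the right-hand side is locally
integrable and the integrated equation holds. In particular `x` is absolutely continuous on compact
subintervals of `[0, ∞)`. The values of `x` before time `-1` play no role. -/
def SolvesMackeyGlass (γ r : ℝ → ℝ) (p : ℝ) (x : ℝ → ℝ) : Prop :=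
  ∀ t : ℝ, 0 ≤ t →
    IntervalIntegrable (mackeyGlassRHS γ r p x) volume 0 t ∧
      x t = x 0 + ∫ s in (0 : ℝ)..t, mackeyGlassRHS γ r p x s

/-- `x` is a global solution with initial value `x₀ = φ`, i.e. `x = φ` on `[-1, 0]`. -/
def SolvesMackeyGlassIVP (γ r : ℝ → ℝ) (p : ℝ) (φ x : ℝ → ℝ) : Prop :=
  EqOn x φ (Icc (-1) 0) ∧ SolvesMackeyGlass γ r p x

/-- The space `C[-1, 0]` with the supremum norm. -/
abbrev SegmentSpace : Type := C(Icc (-1 : ℝ) 0, ℝ)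

/-- The Borel σ-algebra of `C[-1, 0]`. -/
instance : MeasurableSpace SegmentSpace := borel _

instance : BorelSpace SegmentSpace := ⟨rfl⟩

/-- The segment `x_t ∈ C[-1, 0]`, `x_t(θ) = x(t + θ)`, of a continuous path. (Paths on `[-1, ∞)` are
represented by continuous functions on `ℝ`; values before time `-1` are not used.) -/
def pathSegment (x : C(ℝ, ℝ)) (t : ℝ) : SegmentSpace :=
  ⟨fun θ => x (t + θ), by fun_prop⟩

/-- `X` is a random global solution, on the probability space `(Ω, P)`, of the equation with constant
coefficients `γ`, `r`: the initial segment `X_0` is a random variable with values in the nonnegative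
functions of `C[-1, 0]`, and almost every path solves the equation. -/
structure IsRandomSolution {Ω : Type} [MeasurableSpace Ω] (γ r p : ℝ) (P : Measure Ω)
    (X : Ω → C(ℝ, ℝ)) : Prop where
  aemeasurable_initial : AEMeasurable (fun ω => pathSegment (X ω) 0) P
  initial_nonneg : ∀ᵐ ω ∂P, ∀ θ, 0 ≤ pathSegment (X ω) 0 θ
  solves : ∀ᵐ ω ∂P, SolvesMackeyGlass (fun _ => γ) (fun _ => r) p (X ω)

/-- A Borel probability measure `ν` on `C[-1, 0]`, carried by the nonnegative functions, is an
invariant measure of the equation with constant coefficients if (a global solution exists from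
almost every initial function and) every solution whose initial segment has law `ν` has segments
`X_t` of law `ν` at all times `t ≥ 0`. -/
structure IsInvariantMeasure (γ r p : ℝ) (ν : Measure SegmentSpace) : Prop where
  isProbabilityMeasure : IsProbabilityMeasure ν
  nonneg : ∀ᵐ φ ∂ν, ∀ θ, 0 ≤ φ θ
  exists_solution : ∀ᵐ φ ∂ν, ∃ x : C(ℝ, ℝ),
    pathSegment x 0 = φ ∧ SolvesMackeyGlass (fun _ => γ) (fun _ => r) p x
  invariant : ∀ (Ω : Type) [MeasurableSpace Ω] (P : Measure Ω) [IsProbabilityMeasure P]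
    (X : Ω → C(ℝ, ℝ)), IsRandomSolution γ r p P X → HasLaw (fun ω => pathSegment (X ω) 0) ν P →
    ∀ t : ℝ, 0 ≤ t → HasLaw (fun ω => pathSegment (X ω) t) ν P

/-- `μ` is a stationary distribution: there is a random global solution `X` such that `X(t)` has law
`μ` at all times `t ≥ 0`. -/
def IsStationaryDistribution (γ r p : ℝ) (μ : Measure ℝ) : Prop :=
  ∃ (Ω : Type) (_ : MeasurableSpace Ω) (P : Measure Ω) (X : Ω → C(ℝ, ℝ)),
    IsProbabilityMeasure P ∧ IsRandomSolution γ r p P X ∧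
      ∀ t : ℝ, 0 ≤ t → HasLaw (fun ω => X ω t) μ P

/-- The evaluation `φ ↦ φ(0)` on `C[-1, 0]`. -/
def evalAtZero (φ : SegmentSpace) : ℝ := φ ⟨0, by norm_num⟩

/-! Existence is the method of steps: once the delayed term is known, the equation is linear and
variation of constants solves it, with a positive solution (`exists_solvesMackeyGlass`). For
uniqueness, on each unit step the production terms of two solutions agree, so their difference obeys
`d' = -γ d` with `γ ≥ 0` and cannot leave zero (`SolvesMackeyGlass.eqOn`).

Persistence (`exists_pos_forall_le_of_solvesMackeyGlass`) looks at a first time `τ` at which `x`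
drops to a small level `ε`. Just before `τ`, the lagged value exceeds `ε`; it is also `O(ε)`,
because `x` decays at most like `exp (-∫ γ)`. There `y / (1 + y^p)` is nearly `y`, so production, at
least about `c γ ε` with `c > 1`, beats the loss, about `γ ε`. Hence `x` is nondecreasing up to `τ`,
a contradiction.

For constant coefficients the liminf condition says `r > γ`, so there is a positive equilibrium `e`.
The Dirac measure at the constant segment `e` serves as `ν`; uniqueness makes it invariant, and no
compactness argument is needed. -/

/-! ### Absolute continuity and the linear equation. -/

/-- A Lipschitz function of an absolutely continuous function is absolutely continuous. -/
lemma LipschitzOnWith.comp_absolutelyContinuousOnInterval {g f : ℝ → ℝ} {K : NNReal} {s : Set ℝ}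
    {a b : ℝ} (hg : LipschitzOnWith K g s) (hf : AbsolutelyContinuousOnInterval f a b)
    (hs : MapsTo f (uIcc a b) s) : AbsolutelyContinuousOnInterval (fun t => g (f t)) a b := by
  have h0 := Tendsto.const_mul (K : ℝ) hf
  rw [mul_zero] at h0
  refine squeeze_zero' (Eventually.of_forall fun E => Finset.sum_nonneg fun _ _ => dist_nonneg)
    ?_ h0
  refine eventually_inf_principal.mpr (Eventually.of_forall fun E hE => ?_)
  rw [Finset.mul_sum]
  refine Finset.sum_le_sum fun i hi => ?_
  exact hg.dist_le_mul _ (hs (hE.1 i hi).1) _ (hs (hE.1 i hi).2)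

/-- The fundamental theorem of calculus for an absolutely continuous function whose derivative is
known almost everywhere. -/
lemma AbsolutelyContinuousOnInterval.integral_eq_sub_of_ae_hasDerivAt {f f' : ℝ → ℝ} {a b : ℝ}
    (hf : AbsolutelyContinuousOnInterval f a b)
    (hf' : ∀ᵐ t, t ∈ uIcc a b → HasDerivAt f (f' t) t) :
    IntervalIntegrable f' volume a b ∧ ∫ t in a..b, f' t = f b - f a := by
  have h : ∀ᵐ t, t ∈ uIoc a b → deriv f t = f' t := by
    filter_upwards [hf'] with t ht hab
    exact (ht (uIoc_subset_uIcc hab)).deriv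
  refine ⟨hf.intervalIntegrable_deriv.congr_ae ?_, ?_⟩
  · exact (ae_restrict_iff' measurableSet_uIoc).2 h
  · rw [← hf.integral_deriv_eq_sub]
    refine intervalIntegral.integral_congr_ae ?_
    filter_upwards [h] with t ht hab using (ht hab).symm

lemma MeasureTheory.LocallyIntegrable.intervalIntegrable_real {f : ℝ → ℝ}
    (hf : LocallyIntegrable f) {a b : ℝ} : IntervalIntegrable f volume a b :=
  (hf.integrableOn_isCompact isCompact_uIcc).intervalIntegrable

lemma MeasureTheory.LocallyIntegrable.continuous_primitive {f : ℝ → ℝ}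
    (hf : LocallyIntegrable f) (a : ℝ) : Continuous fun t => ∫ s in a..t, f s :=
  intervalIntegral.continuous_primitive (fun _ _ => hf.intervalIntegrable_real) a

/-- The variation of constants formula solves the linear equation `x' = -γ x + q`. -/
lemma variationOfConstants_solves {γ q : ℝ → ℝ} (hγ : LocallyIntegrable γ)
    (hq : LocallyIntegrable q) {x : ℝ → ℝ} {a : ℝ}
    (hx : ∀ t, 0 ≤ t → x t =
      Real.exp (-∫ s in (0 : ℝ)..t, γ s) *
        (a + ∫ s in (0 : ℝ)..t, Real.exp (∫ u in (0 : ℝ)..s, γ u) * q s))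
    {t : ℝ} (ht : 0 ≤ t) :
    IntervalIntegrable (fun s => -γ s * x s + q s) volume 0 t ∧
      x t = x 0 + ∫ s in (0 : ℝ)..t, (-γ s * x s + q s) := by
  set Γ : ℝ → ℝ := fun t => ∫ s in (0 : ℝ)..t, γ s with hΓ
  have hΓc : Continuous Γ := hγ.continuous_primitive 0
  have hQ : IntervalIntegrable (fun s => Real.exp (Γ s) * q s) volume 0 t :=
    hq.intervalIntegrable_real.continuousOn_mul (Real.continuous_exp.comp hΓc).continuousOn
  set v : ℝ → ℝ := fun t => a + ∫ s in (0 : ℝ)..t, Real.exp (Γ s) * q s with hv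
  have hΓac : AbsolutelyContinuousOnInterval Γ 0 t :=
    hγ.intervalIntegrable_real.absolutelyContinuousOnInterval_intervalIntegral left_mem_uIcc
  have hexp : AbsolutelyContinuousOnInterval (fun s => Real.exp (-Γ s)) 0 t := by
    obtain ⟨C, hC⟩ := hΓac.exists_bound
    -- The exponential is only locally Lipschitz, which suffices because `Γ` is bounded on `[0, t]`.
    have hl : ∃ K, LipschitzOnWith K (fun y => Real.exp (-y)) (Icc (-C) C) :=
      ContDiffOn.exists_lipschitzOnWith (n := 1) (by fun_prop) (by simp) (convex_Icc _ _)
        isCompact_Icc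
    obtain ⟨K, hK⟩ := hl
    exact hK.comp_absolutelyContinuousOnInterval hΓac fun s hs => abs_le.1 (hC s hs)
  have hvac : AbsolutelyContinuousOnInterval v 0 t := by
    refine AbsolutelyContinuousOnInterval.fun_add ?_
      (hQ.absolutelyContinuousOnInterval_intervalIntegral left_mem_uIcc)
    exact (LipschitzWith.const a).lipschitzOnWith.absolutelyContinuousOnInterval
  have hd : ∀ᵐ s, s ∈ uIcc 0 t →
      HasDerivAt (fun s => Real.exp (-Γ s) * v s) (-γ s * (Real.exp (-Γ s) * v s) + q s) s := by
    filter_upwards [LocallyIntegrable.ae_hasDerivAt_integral hγ, hQ.ae_hasDerivAt_integral] with s h1 h2 hs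
    have h3 := ((h1 0).neg.exp).mul ((h2 hs 0 left_mem_uIcc).const_add a)
    refine h3.congr_deriv ?_
    have h4 : Real.exp (-Γ s) * Real.exp (Γ s) = 1 := by rw [← Real.exp_add]; simp
    simp only [hv, hΓ] at h4 ⊢
    linear_combination q s * h4
  obtain ⟨h1, h2⟩ := (hexp.fun_mul hvac).integral_eq_sub_of_ae_hasDerivAt hd
  have heq : ∀ s ∈ uIcc 0 t, -γ s * (Real.exp (-Γ s) * v s) + q s = -γ s * x s + q s := by
    intro s hs
    rw [uIcc_of_le ht] at hs
    rw [hx s hs.1]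
  refine ⟨h1.congr fun s hs => heq s (uIoc_subset_uIcc hs), ?_⟩
  rw [← intervalIntegral.integral_congr heq, h2, hx t ht, hx 0 le_rfl]
  ring

/-! ### Measurability of histories and a sign lemma. -/

/-- A function that is right-continuous on `[-1, 0)` is measurable on `[-1, 0]`. -/
lemma measurable_ite_of_rightContinuous {φ : ℝ → ℝ}
    (hφ : ∀ t ∈ Ico (-1 : ℝ) 0, Tendsto φ (𝓝[>] t) (𝓝 (φ t))) (c : ℝ) :
    Measurable fun t => if t ∈ Icc (-1 : ℝ) 0 then φ t else c := by
  classical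
  -- `u n t` is the first point of the grid of mesh `1 / (n + 1)` strictly to the right of `t`; `φ ∘
  -- u n` factors through an integer, hence is measurable.
  set u : ℕ → ℝ → ℝ := fun n t => (⌊(n + 1 : ℝ) * t⌋ + 1) / (n + 1 : ℝ) with hu
  have hlt : ∀ n t, t < u n t := fun n t => by
    rw [hu]; simp only
    rw [lt_div_iff₀ (by positivity), mul_comm]
    exact Int.lt_floor_add_one _
  have hle : ∀ n t, u n t ≤ t + 1 / (n + 1 : ℝ) := fun n t => by
    rw [hu]; simp only
    rw [div_le_iff₀ (by positivity), add_mul t, div_mul_cancel₀ _ (by positivity), mul_comm t]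
    exact add_le_add_left (Int.floor_le _) 1
  have htend : ∀ t, Tendsto (fun n => u n t) atTop (𝓝[>] t) := fun t => by
    refine tendsto_nhdsWithin_iff.2 ⟨?_, Eventually.of_forall fun n => hlt n t⟩
    refine tendsto_of_tendsto_of_tendsto_of_le_of_le tendsto_const_nhds ?_
      (fun n => (hlt n t).le) (fun n => hle n t)
    simpa using (tendsto_one_div_add_atTop_nhds_zero_nat (𝕜 := ℝ)).const_add t
  have hmeas : ∀ n, Measurable fun t => φ (u n t) := fun n =>
    (measurable_from_top (f := fun k : ℤ => φ ((k + 1) / (n + 1 : ℝ)))).comp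
      (Int.measurable_floor.comp (measurable_const_mul (n + 1 : ℝ)))
  -- The endpoint `0` is treated apart: `u n 0` lies outside `[-1, 0]`.
  have h1 : Measurable fun t => if t ∈ Ico (-1 : ℝ) 0 then φ t else if t = 0 then φ 0 else c := by
    refine measurable_of_tendsto_metrizable (f := fun n t =>
      if t ∈ Ico (-1 : ℝ) 0 then φ (u n t) else if t = 0 then φ 0 else c) (fun n => ?_) ?_
    · exact Measurable.ite measurableSet_Ico (hmeas n)
        (Measurable.ite (measurableSet_singleton 0) measurable_const measurable_const)
    · refine tendsto_pi_nhds.2 fun t => ?_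
      by_cases ht : t ∈ Ico (-1 : ℝ) 0
      · simpa only [ht, if_true, Function.comp_def] using (hφ t ht).comp (htend t)
      · simp only [ht, if_false]; exact tendsto_const_nhds
  convert h1 using 2 with t
  grind

/-- If `d` has derivative `f` in the integrated sense, `d 0 = 0`, and `f ≤ 0` wherever `0 ≤ d`, then
`d ≤ 0`. -/
lemma nonpos_of_eq_integral {d f : ℝ → ℝ} {T : ℝ} (hf : IntervalIntegrable f volume 0 T)
    (hd : ∀ t ∈ Icc 0 T, d t = ∫ s in (0 : ℝ)..t, f s)
    (hsign : ∀ s ∈ Icc 0 T, 0 ≤ d s → f s ≤ 0) : ∀ t ∈ Icc 0 T, d t ≤ 0 := by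
  intro t ht
  have h0T : (0 : ℝ) ≤ T := ht.1.trans ht.2
  have hsub : ∀ s ∈ Icc 0 T, IntervalIntegrable f volume 0 s := fun s hs =>
    hf.mono_set (by rw [uIcc_of_le hs.1, uIcc_of_le h0T]; exact Icc_subset_Icc_right hs.2)
  have hc : ContinuousOn d (Icc 0 T) := by
    have := intervalIntegral.continuousOn_primitive_interval' hf left_mem_uIcc
    rw [uIcc_of_le h0T] at this
    exact this.congr hd
  by_contra! hpos
  -- Let `a` be the last time before `t` with `d ≤ 0`. Then `d > 0` and `f ≤ 0` on `(a, t)`, so `d t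
  -- ≤ d a ≤ 0`.
  set S : Set ℝ := Icc 0 t ∩ d ⁻¹' Iic 0 with hS
  have hSc : IsCompact S := by
    refine isCompact_Icc.of_isClosed_subset ?_ inter_subset_left
    exact (hc.mono (Icc_subset_Icc_right ht.2)).preimage_isClosed_of_isClosed isClosed_Icc
      isClosed_Iic
  have h0S : (0 : ℝ) ∈ S := ⟨⟨le_rfl, ht.1⟩, by simp [hd 0 ⟨le_rfl, h0T⟩]⟩
  have hmem := hSc.sSup_mem ⟨0, h0S⟩
  set a := sSup S
  have haT : a ∈ Icc 0 T := ⟨hmem.1.1, hmem.1.2.trans ht.2⟩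
  have hle : ∫ s in a..t, f s ≤ 0 := by
    have : ∫ s in a..t, f s ≤ ∫ s in a..t, (0 : ℝ) := by
      refine intervalIntegral.integral_mono_on_of_le_Ioo hmem.1.2
        ((hsub a haT).symm.trans (hsub t ht)) (by simp) fun s hs => ?_
      have hs0T : s ∈ Icc 0 T := ⟨haT.1.trans hs.1.le, hs.2.le.trans ht.2⟩
      refine hsign s hs0T ?_
      by_contra! hneg
      exact absurd (le_csSup hSc.bddAbove (show s ∈ S from ⟨⟨hs0T.1, hs.2.le⟩, hneg.le⟩))
        (not_le.2 hs.1)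
    simpa using this
  have := intervalIntegral.integral_add_adjacent_intervals (hsub a haT)
    ((hsub a haT).symm.trans (hsub t ht))
  have h3 : d a ≤ 0 := hmem.2
  rw [← hd a haT, ← hd t ht] at this
  linarith

/-! ### Existence by the method of steps. -/

/-- The Mackey–Glass production function `g(y) = y / (1 + y^p)`. -/
noncomputable def mackeyGlassProd (p y : ℝ) : ℝ := y / (1 + y ^ p)

lemma measurable_mackeyGlassProd (p : ℝ) : Measurable (mackeyGlassProd p) := by
  unfold mackeyGlassProd; fun_prop

lemma mackeyGlassProd_nonneg (p : ℝ) {y : ℝ} (hy : 0 ≤ y) : 0 ≤ mackeyGlassProd p y := by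
  have := Real.rpow_nonneg hy p
  unfold mackeyGlassProd; positivity

lemma mackeyGlassProd_le_one {p y : ℝ} (hp : 1 < p) (hy : 0 ≤ y) : mackeyGlassProd p y ≤ 1 := by
  have h := Real.rpow_nonneg hy p
  unfold mackeyGlassProd
  rw [div_le_one (by positivity)]
  rcases le_total y 1 with h1 | h1
  · linarith
  · have := Real.rpow_le_rpow_of_exponent_le h1 hp.le
    rw [Real.rpow_one] at this
    linarith

section Linear

variable {γ r : ℝ → ℝ} {p R : ℝ}

/-- One iteration of the method of steps: solve the linear equation with delayed term `h`. -/
noncomputable def mackeyGlassStep (γ r : ℝ → ℝ) (p : ℝ) (φ h : ℝ → ℝ) (t : ℝ) : ℝ :=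
  if t ≤ 0 then φ t else
    Real.exp (-∫ s in (0 : ℝ)..t, γ s) * (φ 0 + ∫ s in (0 : ℝ)..t,
      Real.exp (∫ u in (0 : ℝ)..s, γ u) * (r s * mackeyGlassProd p (h (s - 1))))

lemma locallyIntegrable_production (hp : 1 < p) (hr : AEMeasurable r) (hr0 : ∀ t, 0 ≤ r t)
    (hrR : ∀ t, r t ≤ R) {h : ℝ → ℝ} (hm : Measurable h) (hh : ∀ t, 0 < h t) :
    LocallyIntegrable fun s => r s * mackeyGlassProd p (h (s - 1)) := by
  refine (locallyIntegrable_const R).mono ?_ (Eventually.of_forall fun s => ?_)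
  · refine (hr.mul (Measurable.aemeasurable ?_)).aestronglyMeasurable
    exact (measurable_mackeyGlassProd p).comp (hm.comp (measurable_id.sub_const 1))
  · have h1 := mackeyGlassProd_nonneg p (hh (s - 1)).le
    have h2 := mackeyGlassProd_le_one hp (hh (s - 1)).le
    rw [Real.norm_of_nonneg (mul_nonneg (hr0 s) h1),
      Real.norm_of_nonneg ((hr0 s).trans (hrR s))]
    nlinarith [hr0 s, hrR s]

lemma locallyIntegrable_exp_mul (hγ : LocallyIntegrable γ) {q : ℝ → ℝ}
    (hq : LocallyIntegrable q) :
    LocallyIntegrable fun s => Real.exp (∫ u in (0 : ℝ)..s, γ u) * q s :=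
  hq.continuous_mul (Real.continuous_exp.comp (hγ.continuous_primitive 0))

lemma mackeyGlassStep_pos (hr0 : ∀ t, 0 ≤ r t) {φ h : ℝ → ℝ} (hφ : ∀ t, 0 < φ t)
    (hh : ∀ t, 0 < h t) (t : ℝ) : 0 < mackeyGlassStep γ r p φ h t := by
  unfold mackeyGlassStep
  split_ifs with ht
  · exact hφ t
  · have : 0 ≤ ∫ s in (0 : ℝ)..t,
        Real.exp (∫ u in (0 : ℝ)..s, γ u) * (r s * mackeyGlassProd p (h (s - 1))) :=
      intervalIntegral.integral_nonneg (not_le.1 ht).le fun s _ => mul_nonneg (Real.exp_pos _).le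
        (mul_nonneg (hr0 s) (mackeyGlassProd_nonneg p (hh _).le))
    have := hφ 0
    positivity

lemma measurable_mackeyGlassStep (hp : 1 < p) (hγ : LocallyIntegrable γ) (hr : AEMeasurable r)
    (hr0 : ∀ t, 0 ≤ r t) (hrR : ∀ t, r t ≤ R) {φ h : ℝ → ℝ} (hφm : Measurable φ)
    (hm : Measurable h) (hh : ∀ t, 0 < h t) : Measurable (mackeyGlassStep γ r p φ h) := by
  refine Measurable.ite measurableSet_Iic hφm (Continuous.measurable ?_)
  have h1 := hγ.continuous_primitive 0
  have h2 := (locallyIntegrable_exp_mul hγ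
    (locallyIntegrable_production hp hr hr0 hrR hm hh)).continuous_primitive 0
  fun_prop

/-- The unit delay gains one unit of time per step; this is what makes the iteration stabilise. -/
lemma mackeyGlassStep_congr {φ h k : ℝ → ℝ} {T : ℝ} (hhk : ∀ t ≤ T, h t = k t) {t : ℝ}
    (ht : t ≤ T + 1) : mackeyGlassStep γ r p φ h t = mackeyGlassStep γ r p φ k t := by
  unfold mackeyGlassStep
  split_ifs with h0
  · rfl
  · congr 2
    refine intervalIntegral.integral_congr fun s hs => ?_
    rw [uIcc_of_le (not_le.1 h0).le] at hs
    rw [hhk (s - 1) (by linarith [hs.2])]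

/-- Method of steps: the integrated equation has a positive measurable solution. -/
lemma exists_mackeyGlassStep_fixed (hp : 1 < p) (hγ : LocallyIntegrable γ) (hr : AEMeasurable r)
    (hr0 : ∀ t, 0 ≤ r t) (hrR : ∀ t, r t ≤ R) {φ : ℝ → ℝ} (hφm : Measurable φ)
    (hφ : ∀ t, 0 < φ t) :
    ∃ x : ℝ → ℝ, Measurable x ∧ (∀ t, 0 < x t) ∧ ∀ t, x t = mackeyGlassStep γ r p φ x t := by
  set X : ℕ → ℝ → ℝ := fun n => (mackeyGlassStep γ r p φ)^[n] φ with hX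
  have hsucc : ∀ n, X (n + 1) = mackeyGlassStep γ r p φ (X n) := fun n =>
    Function.iterate_succ_apply' _ _ _
  have hpos : ∀ n t, 0 < X n t := by
    intro n
    induction n with
    | zero => exact hφ
    | succ n ih => rw [hsucc]; exact mackeyGlassStep_pos hr0 hφ ih
  have hmeas : ∀ n, Measurable (X n) := by
    intro n
    induction n with
    | zero => exact hφm
    | succ n ih =>
      rw [hsucc]; exact measurable_mackeyGlassStep hp hγ hr hr0 hrR hφm ih (hpos n)
  have hstab : ∀ n : ℕ, ∀ t ≤ (n : ℝ), X (n + 1) t = X n t := by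
    intro n
    induction n with
    | zero =>
      intro t ht
      rw [hsucc]
      have : t ≤ 0 := by simpa using ht
      simp [mackeyGlassStep, this, hX]
    | succ n ih =>
      intro t ht
      rw [hsucc (n + 1)]
      conv_rhs => rw [hsucc n]
      exact mackeyGlassStep_congr ih (by simpa using ht)
  have hstab' : ∀ {n m : ℕ}, n ≤ m → ∀ t ≤ (n : ℝ), X m t = X n t := by
    intro n m hnm
    induction m, hnm using Nat.le_induction with
    | base => intro t _; rfl
    | succ m hm ih =>
      intro t ht
      rw [hstab m t (ht.trans (by exact_mod_cast hm)), ih t ht]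
  have hx : ∀ n : ℕ, ∀ t ≤ (n : ℝ), X ⌈t⌉₊ t = X n t := fun n t ht =>
    (hstab' (Nat.ceil_le.2 ht) t (Nat.le_ceil t)).symm
  -- The iterates are frozen on `t ≤ n` from index `n` on, so this diagonal is their pointwise
  -- limit. For `t ≤ 0` the index is `0` and the value is `φ t`.
  refine ⟨fun t => X ⌈t⌉₊ t, ?_, fun t => hpos _ t, fun t => ?_⟩
  · refine measurable_of_tendsto_metrizable hmeas (tendsto_pi_nhds.2 fun t => ?_)
    refine tendsto_const_nhds.congr' ?_
    filter_upwards [eventually_ge_atTop ⌈t⌉₊] with n hn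
    exact hx n t (Nat.ceil_le.1 hn)
  · have ht : t ≤ (⌈t⌉₊ : ℝ) + 1 := (Nat.le_ceil t).trans (by linarith)
    simp only
    rw [mackeyGlassStep_congr (hx ⌈t⌉₊) ht, ← hsucc, hstab _ t (Nat.le_ceil t)]

/-- Existence of a positive global solution; moreover `x` decays no faster than `exp (-∫ γ)`. -/
lemma exists_solvesMackeyGlass (hp : 1 < p) (hγ : LocallyIntegrable γ)
    (hr : AEMeasurable r) (hr0 : ∀ t, 0 ≤ r t) (hrR : ∀ t, r t ≤ R) {φ : ℝ → ℝ}
    (hφm : Measurable φ) (hφ : ∀ t, 0 < φ t) :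
    ∃ x : ℝ → ℝ, (∀ t ≤ 0, x t = φ t) ∧ (∀ t, 0 < x t) ∧ SolvesMackeyGlass γ r p x ∧
      ContinuousOn x (Ici 0) ∧
      ∀ a b, 0 ≤ a → a ≤ b → x a ≤ Real.exp (∫ s in a..b, γ s) * x b := by
  obtain ⟨x, hxm, hx0, hx⟩ := exists_mackeyGlassStep_fixed (p := p) hp hγ hr hr0 hrR hφm hφ
  have hq := locallyIntegrable_production hp hr hr0 hrR hxm hx0
  have heq := locallyIntegrable_exp_mul hγ hq
  have hform : ∀ t, 0 ≤ t → x t = Real.exp (-∫ s in (0 : ℝ)..t, γ s) * (φ 0 +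
      ∫ s in (0 : ℝ)..t,
        Real.exp (∫ u in (0 : ℝ)..s, γ u) * (r s * mackeyGlassProd p (x (s - 1)))) := by
    intro t ht
    rw [hx t]
    rcases ht.eq_or_lt with rfl | ht
    · simp [mackeyGlassStep]
    · simp [mackeyGlassStep, not_le.2 ht]
  refine ⟨x, fun t ht => by rw [hx t]; simp [mackeyGlassStep, ht], hx0,
    fun t ht => variationOfConstants_solves hγ hq hform ht, ?_, fun a b ha hab => ?_⟩
  · refine ContinuousOn.congr (Continuous.continuousOn ?_) hform
    have h1 := hγ.continuous_primitive 0
    have h2 := heq.continuous_primitive 0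
    fun_prop
  -- Nonnegative production makes `exp (∫ γ) * x` nondecreasing.
  · have hadj := intervalIntegral.integral_add_adjacent_intervals
      (hγ.intervalIntegrable_real (a := 0) (b := a)) (hγ.intervalIntegrable_real (b := b))
    have hadj' := intervalIntegral.integral_add_adjacent_intervals
      (heq.intervalIntegrable_real (a := 0) (b := a)) (heq.intervalIntegrable_real (b := b))
    have hnn : 0 ≤ ∫ s in a..b,
        Real.exp (∫ u in (0 : ℝ)..s, γ u) * (r s * mackeyGlassProd p (x (s - 1))) :=
      intervalIntegral.integral_nonneg hab fun s _ => mul_nonneg (Real.exp_pos _).le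
        (mul_nonneg (hr0 s) (mackeyGlassProd_nonneg p (hx0 _).le))
    rw [hform a ha, hform b (ha.trans hab), ← mul_assoc, ← Real.exp_add, ← hadj, ← hadj',
      neg_add, add_neg_cancel_comm_assoc]
    gcongr
    linarith

end Linear

/-! ### Uniqueness and persistence. -/

/-- Two solutions with the same history coincide. -/
lemma SolvesMackeyGlass.eqOn {γ r : ℝ → ℝ} {p : ℝ} (hγ : ∀ t, 0 ≤ t → 0 ≤ γ t) {x y : ℝ → ℝ}
    (hx : SolvesMackeyGlass γ r p x) (hy : SolvesMackeyGlass γ r p y)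
    (hxy : EqOn x y (Icc (-1) 0)) : EqOn x y (Ici (-1)) := by
  have key : ∀ {x y : ℝ → ℝ}, SolvesMackeyGlass γ r p x → SolvesMackeyGlass γ r p y →
      ∀ T : ℝ, 0 ≤ T → EqOn x y (Icc (-1) T) → ∀ t ∈ Icc 0 (T + 1), x t - y t ≤ 0 := by
    intro x y hx hy T hT hxy
    refine nonpos_of_eq_integral (f := fun s => mackeyGlassRHS γ r p x s - mackeyGlassRHS γ r p y s)
      ((hx _ (by linarith)).1.sub (hy _ (by linarith)).1) (fun t ht => ?_) fun s hs hd => ?_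
    · rw [intervalIntegral.integral_sub (hx t ht.1).1 (hy t ht.1).1, (hx t ht.1).2, (hy t ht.1).2,
        hxy (show (0 : ℝ) ∈ Icc (-1) T from ⟨by norm_num, hT⟩)]
      ring
    · have : x (s - 1) = y (s - 1) := hxy ⟨by linarith [hs.1], by linarith [hs.2]⟩
      simp only [mackeyGlassRHS, this]
      nlinarith [hγ s hs.1]
  have hn : ∀ n : ℕ, EqOn x y (Icc (-1) n) := by
    intro n
    induction n with
    | zero => simpa using hxy
    | succ n ih =>
      intro t ht
      rcases le_total t 0 with h0 | h0
      · exact hxy ⟨ht.1, h0⟩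
      · have ht' : t ∈ Icc 0 ((n : ℝ) + 1) := ⟨h0, by simpa using ht.2⟩
        have h1 := key hx hy n n.cast_nonneg ih t ht'
        have h2 := key hy hx n n.cast_nonneg ih.symm t ht'
        linarith
  intro t ht
  exact hn ⌈t⌉₊ ⟨ht, Nat.le_ceil t⟩

/-- Persistence: a positive solution is bounded away from zero if `c γ ≤ r` eventually for some
`c > 1`. -/
lemma exists_pos_forall_le_of_solvesMackeyGlass {γ r : ℝ → ℝ} {p R c T m : ℝ} (hp : 1 < p)
    (hγ : LocallyIntegrable γ) (hγ0 : ∀ t, 0 ≤ γ t) (hr0 : ∀ t, 0 ≤ r t) (hrR : ∀ t, r t ≤ R)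
    (hc : 1 < c) (hT : 0 ≤ T) (hcγ : ∀ t, T ≤ t → c * γ t ≤ r t) {x : ℝ → ℝ}
    (hm : 0 < m) (hxm : ∀ t ∈ Icc (-1 : ℝ) 0, m ≤ x t) (hx0 : ∀ t, 0 < x t)
    (hx : SolvesMackeyGlass γ r p x) (hxc : ContinuousOn x (Ici 0))
    (hdecay : ∀ a b, 0 ≤ a → a ≤ b → x a ≤ Real.exp (∫ s in a..b, γ s) * x b) :
    ∃ ε > 0, ∀ t, -1 ≤ t → ε ≤ x t := by
  -- One factor `1 + η` will absorb the denominator `1 + y^p`, the other the overshoot of `x` above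
  -- `ε`. For `η ≤ 1`, `(1 + η)^2 ≤ 1 + 3 * η`.
  obtain ⟨η, hη0, hη1, hηc⟩ : ∃ η : ℝ, 0 < η ∧ η ≤ 1 ∧ (1 + η) ^ 2 ≤ c := by
    refine ⟨min 1 ((c - 1) / 3), by have := sub_pos.2 hc; positivity, min_le_left _ _, ?_⟩
    have h1 := min_le_left 1 ((c - 1) / 3)
    have h2 := min_le_right 1 ((c - 1) / 3)
    have h3 : 0 < min 1 ((c - 1) / 3) := by have := sub_pos.2 hc; positivity
    nlinarith
  -- Beyond `T + 1` the whole delay window `[s - 1, s]` lies where `c * γ ≤ r`.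
  obtain ⟨m', hm', hxm'⟩ : ∃ m' > 0, ∀ t ∈ Icc (0 : ℝ) (T + 1), m' ≤ x t := by
    obtain ⟨t₀, -, ht₀⟩ := isCompact_Icc.exists_isMinOn (nonempty_Icc.2 (by linarith))
      (hxc.mono (fun s (hs : s ∈ Icc (0 : ℝ) (T + 1)) => hs.1))
    exact ⟨x t₀, hx0 t₀, fun t ht => ht₀ ht⟩
  -- `2 * ε` bounds `(1 + η) * ε`, and `exp R` bounds the decay over one delay, since `γ ≤ r ≤ R`
  -- there.
  obtain ⟨ε, hε0, hεm, hεm', hεη⟩ : ∃ ε : ℝ, 0 < ε ∧ ε < m ∧ ε < m' ∧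
      (Real.exp R * (2 * ε)) ^ p ≤ η := by
    have hcont : Tendsto (fun ε : ℝ => (Real.exp R * (2 * ε)) ^ p) (𝓝 0) (𝓝 0) := by
      have : Continuous fun ε : ℝ => (Real.exp R * (2 * ε)) ^ p :=
        (by fun_prop : Continuous fun ε : ℝ => Real.exp R * (2 * ε)).rpow_const
          fun _ => Or.inr (by linarith)
      simpa [Real.zero_rpow (by linarith : p ≠ 0)] using this.tendsto 0
    have h1 : ∀ᶠ ε in 𝓝[>] (0 : ℝ), (Real.exp R * (2 * ε)) ^ p ≤ η :=
      (hcont.mono_left nhdsWithin_le_nhds).eventually_le_const hη0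
    have h2 : ∀ᶠ ε in 𝓝[>] (0 : ℝ), ε < min m m' :=
      (eventually_lt_nhds (lt_min hm hm')).filter_mono nhdsWithin_le_nhds
    obtain ⟨ε, ⟨h1, h2⟩, h3⟩ := ((h1.and h2).and self_mem_nhdsWithin).exists
    exact ⟨ε, h3, h2.trans_le (min_le_left _ _), h2.trans_le (min_le_right _ _), h1⟩
  refine ⟨ε, hε0, ?_⟩
  have hbefore : ∀ t, -1 ≤ t → t ≤ T + 1 → ε < x t := by
    intro t h1 h2
    rcases le_total t 0 with h | h
    · exact hεm.trans_le (hxm t ⟨h1, h⟩)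
    · exact hεm'.trans_le (hxm' t ⟨h, h2⟩)
  by_contra! hcon
  obtain ⟨t₁, ht₁, hxt₁⟩ := hcon
  set S : Set ℝ := Ici (T + 1) ∩ x ⁻¹' Iic ε with hS
  have hSc : IsClosed S :=
    (hxc.mono (Ici_subset_Ici.2 (by linarith))).preimage_isClosed_of_isClosed isClosed_Ici
      isClosed_Iic
  have ht₁S : t₁ ∈ S := by
    refine ⟨?_, hxt₁.le⟩
    by_contra h
    exact absurd hxt₁ (not_lt.2 (hbefore t₁ ht₁ (not_le.1 h).le).le)
  have hbdd : BddBelow S := ⟨T + 1, fun s hs => hs.1⟩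
  have hτ := hSc.csInf_mem ⟨t₁, ht₁S⟩ hbdd
  set τ := sInf S
  have hτε : x τ ≤ ε := hτ.2
  have hlt : ∀ s, -1 ≤ s → s < τ → ε < x s := by
    intro s h1 h2
    rcases le_total s (T + 1) with h | h
    · exact hbefore s h1 h
    · by_contra! hs
      exact absurd (csInf_le hbdd (show s ∈ S from ⟨h, hs⟩)) (not_le.2 h2)
  have hTτ : T + 1 < τ := by
    refine lt_of_le_of_ne hτ.1 fun h => ?_
    exact absurd hτε (not_le.2 (hbefore τ (by linarith) h.ge))
  have hcτ : ContinuousAt x τ := hxc.continuousAt (Ici_mem_nhds (by linarith))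
  -- By continuity `x` is barely above `ε` on some `[a, τ]`; a nonnegative right-hand side there
  -- would give `x a ≤ x τ ≤ ε`, although `a < τ`.
  obtain ⟨a, haT, haτ, hax⟩ : ∃ a, T + 1 ≤ a ∧ a < τ ∧ ∀ s ∈ Icc a τ, x s ≤ (1 + η) * ε := by
    have h1 : ∀ᶠ s in 𝓝 τ, x s ≤ (1 + η) * ε :=
      hcτ.eventually_le_const (hτε.trans_lt (by nlinarith))
    obtain ⟨δ, hδ, hball⟩ := Metric.eventually_nhds_iff.1 h1
    refine ⟨max (T + 1) (τ - δ / 2), le_max_left _ _, max_lt hTτ (by linarith), fun s hs => ?_⟩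
    refine hball ?_
    have := (le_max_right _ _).trans hs.1
    rw [Real.dist_eq, abs_lt]
    constructor <;> linarith [hs.2]
  have hrhs : ∀ s ∈ Icc a τ, 0 ≤ mackeyGlassRHS γ r p x s := by
    intro s hs
    have hs1 : ε < x (s - 1) := hlt _ (by linarith [hs.1]) (by linarith [hs.2])
    have hint : ∫ u in (s - 1)..s, γ u ≤ R := by
      have : ∫ u in (s - 1)..s, γ u ≤ ∫ u in (s - 1)..s, R := by
        refine intervalIntegral.integral_mono_on (by linarith) hγ.intervalIntegrable_real
          (by simp) fun u hu => ?_
        have h1 := hcγ u (by linarith [hu.1, hs.1])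
        nlinarith [hγ0 u, hrR u]
      simpa using this
    have hup : x (s - 1) ≤ Real.exp R * (2 * ε) := by
      refine (hdecay (s - 1) s (by linarith [hs.1]) (by linarith)).trans ?_
      have := hax s hs
      have h0 := (hx0 s).le
      gcongr
      nlinarith
    have hpow : x (s - 1) ^ p ≤ η :=
      (Real.rpow_le_rpow (hx0 _).le hup (by linarith)).trans hεη
    have hpow0 := Real.rpow_nonneg (hx0 (s - 1)).le p
    have hg : ε / (1 + η) ≤ x (s - 1) / (1 + x (s - 1) ^ p) := by
      have h0 := (hx0 (s - 1)).le
      gcongr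
    have h2 : γ s * x s ≤ r s * (ε / (1 + η)) := by
      calc γ s * x s ≤ γ s * ((1 + η) * ε) := by
            have := hax s hs
            have := hγ0 s
            gcongr
        _ = ((1 + η) ^ 2 * γ s) * (ε / (1 + η)) := by field_simp
        _ ≤ r s * (ε / (1 + η)) := by
            have h3 := hcγ s (by linarith [hs.1])
            have h4 : (1 + η) ^ 2 * γ s ≤ c * γ s := by have := hγ0 s; gcongr
            have := h4.trans h3
            gcongr
    have h3 := mul_le_mul_of_nonneg_left hg (hr0 s)
    simp only [mackeyGlassRHS]
    linarith
  have ha := hx a (by linarith)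
  have hτ' := hx τ (by linarith)
  have hsplit := intervalIntegral.integral_add_adjacent_intervals ha.1 (ha.1.symm.trans hτ'.1)
  have hnn : 0 ≤ ∫ s in a..τ, mackeyGlassRHS γ r p x s :=
    intervalIntegral.integral_nonneg haτ.le hrhs
  have := hlt a (by linarith) haτ
  linarith [ha.2, hτ'.2]

/-! ### Assembling the first claim. -/

/-- Only the values of the coefficients at nonnegative times matter. -/
lemma SolvesMackeyGlass.congr {γ γ' r r' : ℝ → ℝ} {p : ℝ} {x : ℝ → ℝ}
    (hx : SolvesMackeyGlass γ r p x) (hγ : EqOn γ γ' (Ici 0)) (hr : EqOn r r' (Ici 0)) :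
    SolvesMackeyGlass γ' r' p x := by
  intro t ht
  have h : EqOn (mackeyGlassRHS γ r p x) (mackeyGlassRHS γ' r' p x) (uIcc 0 t) := by
    intro s hs
    rw [uIcc_of_le ht] at hs
    simp only [mackeyGlassRHS, hγ (show s ∈ Ici 0 from hs.1), hr (show s ∈ Ici 0 from hs.1)]
  rw [← intervalIntegral.integral_congr h]
  exact ⟨(hx t ht).1.congr (h.mono uIoc_subset_uIcc), (hx t ht).2⟩

lemma MeasureTheory.LocallyIntegrableOn.locallyIntegrable_indicator {f : ℝ → ℝ} {s : Set ℝ}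
    (hf : LocallyIntegrableOn f s) (hs : IsClosed s) : LocallyIntegrable (s.indicator f) := by
  refine locallyIntegrable_iff.2 fun K hK => ?_
  rw [IntegrableOn, integrable_indicator_iff hs.measurableSet, IntegrableOn,
    Measure.restrict_restrict hs.measurableSet]
  exact hf.integrableOn_compact_subset inter_subset_left (hK.inter_left hs)

/-- Global existence, uniqueness and persistence for càdlàg histories bounded away from zero. -/
theorem existsUnique_persistent_solution {p : ℝ} (hp : 1 < p) {γ r : ℝ → ℝ}
    (hγ_pos : ∀ t : ℝ, 0 ≤ t → 0 < γ t) (hr_pos : ∀ t : ℝ, 0 ≤ t → 0 < r t)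
    (hγ_int : LocallyIntegrableOn γ (Ici 0) volume)
    (hr_meas : AEMeasurable r (volume.restrict (Ici 0)))
    (hr_bdd : BddAbove (r '' Ici 0))
    (hlim : 1 < liminf (fun t : ℝ => ((r t / γ t : ℝ) : EReal)) atTop)
    {φ : ℝ → ℝ} (hφ : IsCadlagHistory φ) (hφ0 : 0 < sInf (φ '' Icc (-1) 0)) :
    ∃ x : ℝ → ℝ, SolvesMackeyGlassIVP γ r p φ x ∧
      (∀ y : ℝ → ℝ, SolvesMackeyGlassIVP γ r p φ y → EqOn y x (Ici (-1))) ∧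
      0 < sInf (x '' Ici 0) := by
  set γ' : ℝ → ℝ := (Ici 0).indicator γ with hγ'
  set r' : ℝ → ℝ := (Ici 0).indicator r with hr'
  have eqγ : EqOn γ' γ (Ici 0) := fun t ht => indicator_of_mem ht γ
  have eqr : EqOn r' r (Ici 0) := fun t ht => indicator_of_mem ht r
  have hγ'i : LocallyIntegrable γ' := hγ_int.locallyIntegrable_indicator isClosed_Ici
  have hr'm : AEMeasurable r' := (aemeasurable_indicator_iff measurableSet_Ici).2 hr_meas
  have hγ'0 : ∀ t, 0 ≤ γ' t := fun t => indicator_nonneg (fun s hs => (hγ_pos s hs).le) t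
  have hr'0 : ∀ t, 0 ≤ r' t := fun t => indicator_nonneg (fun s hs => (hr_pos s hs).le) t
  obtain ⟨R, hR⟩ := hr_bdd
  have hR' : ∀ t, 0 ≤ t → r t ≤ R := fun t ht => hR (mem_image_of_mem r ht)
  have hr'R : ∀ t, r' t ≤ R := fun t => by
    by_cases ht : t ∈ Ici (0 : ℝ)
    · rw [eqr ht]; exact hR' t ht
    · rw [hr', indicator_of_notMem ht]
      exact (hr_pos 0 le_rfl).le.trans (hR' 0 le_rfl)
  -- `sInf` of a set unbounded below is `0` by convention, so a positive infimum is a genuine lower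
  -- bound.
  have hbdd : BddBelow (φ '' Icc (-1) 0) := by
    by_contra h
    exact hφ0.ne' (Real.sInf_of_not_bddBelow h)
  set m := sInf (φ '' Icc (-1) 0) with hm
  have hφm : ∀ t ∈ Icc (-1 : ℝ) 0, m ≤ φ t := fun t ht => csInf_le hbdd (mem_image_of_mem φ ht)
  have hφ'pos : ∀ t, 0 < if t ∈ Icc (-1 : ℝ) 0 then φ t else 1 := fun t => by
    split_ifs with ht
    · exact hφ0.trans_le (hφm t ht)
    · exact one_pos
  obtain ⟨x, hxφ', hx0, hx, hxc, hdecay⟩ := exists_solvesMackeyGlass hp hγ'i hr'm hr'0 hr'R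
    (measurable_ite_of_rightContinuous hφ.1 1) hφ'pos
  have hxφ : EqOn x φ (Icc (-1) 0) := fun t ht => by rw [hxφ' t ht.2, if_pos ht]
  -- The liminf may be infinite; a real `c` strictly between `1` and it suffices.
  obtain ⟨c, hc1, hc⟩ := EReal.lt_iff_exists_real_btwn.1 hlim
  obtain ⟨T, hT⟩ := eventually_atTop.1 (eventually_lt_of_lt_liminf hc)
  have hcγ : ∀ t, max T 0 ≤ t → c * γ' t ≤ r' t := by
    intro t ht
    have ht0 : 0 ≤ t := (le_max_right _ _).trans ht
    have h1 := EReal.coe_lt_coe_iff.1 (hT t ((le_max_left _ _).trans ht))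
    rw [eqγ (mem_Ici.2 ht0), eqr (mem_Ici.2 ht0)]
    exact ((lt_div_iff₀ (hγ_pos t ht0)).1 h1).le
  obtain ⟨ε, hε, hxε⟩ := exists_pos_forall_le_of_solvesMackeyGlass hp hγ'i hγ'0 hr'0 hr'R
    (by exact_mod_cast hc1) (le_max_right T 0) hcγ hφ0
    (fun t ht => (hφm t ht).trans_eq (hxφ ht).symm) hx0 hx hxc hdecay
  have hxs : SolvesMackeyGlass γ r p x := hx.congr eqγ eqr
  refine ⟨x, ⟨hxφ, hxs⟩, fun y hy => ?_, hε.trans_le ?_⟩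
  · exact hy.2.eqOn (fun t ht => (hγ_pos t ht).le) hxs (hy.1.trans hxφ.symm)
  · refine le_csInf (nonempty_Ici.image x) ?_
    rintro _ ⟨t, ht, rfl⟩
    exact hxε t (by linarith [mem_Ici.1 ht])

/-! ### Equilibria, invariant measures and the main theorem. -/

/-- A constant path at an equilibrium is a solution. -/
lemma solvesMackeyGlass_const {γ r p e : ℝ} (he : r * (e / (1 + e ^ p)) = γ * e) :
    SolvesMackeyGlass (fun _ => γ) (fun _ => r) p (ContinuousMap.const ℝ e) := by
  have h : mackeyGlassRHS (fun _ => γ) (fun _ => r) p (ContinuousMap.const ℝ e) = fun _ => 0 := by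
    ext s
    simp [mackeyGlassRHS, he]
  intro t _
  rw [h]
  simp

/-- A random solution whose initial segment is almost surely an equilibrium stays there. -/
lemma IsRandomSolution.ae_pathSegment_eq_const {Ω : Type} [MeasurableSpace Ω] {γ r p e : ℝ}
    (hγ : 0 ≤ γ) (he : r * (e / (1 + e ^ p)) = γ * e) {P : Measure Ω} {X : Ω → C(ℝ, ℝ)}
    (hX : IsRandomSolution γ r p P X)
    (h0 : ∀ᵐ ω ∂P, pathSegment (X ω) 0 = ContinuousMap.const _ e) {t : ℝ} (ht : 0 ≤ t) :
    ∀ᵐ ω ∂P, pathSegment (X ω) t = ContinuousMap.const _ e := by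
  filter_upwards [hX.solves, h0] with ω hω h0ω
  have h1 : EqOn (X ω) (ContinuousMap.const ℝ e) (Ici (-1)) := by
    refine hω.eqOn (fun _ _ => hγ) (solvesMackeyGlass_const he) fun θ hθ => ?_
    simpa [pathSegment] using DFunLike.congr_fun h0ω ⟨θ, hθ⟩
  ext θ
  exact h1 (mem_Ici.2 (by linarith [θ.2.1]))

/-- The Dirac measure at an equilibrium is an invariant measure. -/
theorem isInvariantMeasure_dirac_const {γ r p e : ℝ} (hγ : 0 ≤ γ) (he0 : 0 ≤ e)
    (he : r * (e / (1 + e ^ p)) = γ * e) :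
    IsInvariantMeasure γ r p (Measure.dirac (ContinuousMap.const _ e)) where
  isProbabilityMeasure := inferInstance
  nonneg := by
    rw [ae_dirac_eq]
    exact fun _ => he0
  exists_solution := by
    rw [ae_dirac_eq]
    exact ⟨ContinuousMap.const ℝ e, by ext; rfl, solvesMackeyGlass_const he⟩
  invariant Ω _ P _ X hX hlaw t ht := by
    -- A Dirac law pins the initial segment almost surely, and uniqueness then pins the path.
    have h0 : ∀ᵐ ω ∂P, pathSegment (X ω) 0 = ContinuousMap.const _ e := by
      refine ae_of_ae_map hlaw.aemeasurable (p := fun φ => φ = ContinuousMap.const _ e) ?_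
      rw [hlaw.map_eq, ae_dirac_eq]
      exact rfl
    have ht' := hX.ae_pathSegment_eq_const hγ he h0 ht
    exact ⟨aemeasurable_const.congr (ht'.mono fun _ h => h.symm), by
      rw [Measure.map_congr ht', Measure.map_const, measure_univ, one_smul]⟩

theorem isStationaryDistribution_dirac {γ r p e : ℝ} (he0 : 0 ≤ e)
    (he : r * (e / (1 + e ^ p)) = γ * e) :
    IsStationaryDistribution γ r p (Measure.dirac e) := by
  refine ⟨Unit, inferInstance, Measure.dirac (), fun _ => ContinuousMap.const ℝ e, inferInstance,
    ⟨aemeasurable_const, .of_forall fun _ _ => he0, .of_forall fun _ => solvesMackeyGlass_const he⟩,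
    fun t _ => ⟨aemeasurable_const, ?_⟩⟩
  simp

/-- For `γ < r` there is a positive equilibrium, namely `(r / γ - 1)^(1/p)`. -/
lemma exists_pos_equilibrium {γ r p : ℝ} (hp : 1 < p) (hγ : 0 < γ) (hr : γ < r) :
    ∃ e > 0, r * (e / (1 + e ^ p)) = γ * e := by
  have h1 : 0 < r / γ - 1 := sub_pos.2 ((one_lt_div hγ).2 hr)
  refine ⟨(r / γ - 1) ^ p⁻¹, Real.rpow_pos_of_pos h1 _, ?_⟩
  have h2 : r ≠ 0 := (hγ.trans hr).ne'
  rw [Real.rpow_inv_rpow h1.le (by linarith), add_sub_cancel, div_div_eq_mul_div]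
  field_simp

lemma continuous_evalAtZero : Continuous evalAtZero :=
  continuous_eval_const _

theorem corollary1p2 (p : ℝ) (hp : 1 < p) (γ r : ℝ → ℝ)
    (hγ_pos : ∀ t : ℝ, 0 ≤ t → 0 < γ t) (hr_pos : ∀ t : ℝ, 0 ≤ t → 0 < r t)
    (hγ_int : LocallyIntegrableOn γ (Ici 0) volume)
    (hr_meas : AEMeasurable r (volume.restrict (Ici 0)))
    (hr_bdd : BddAbove (r '' Ici 0))
    (hlim : 1 < liminf (fun t : ℝ => ((r t / γ t : ℝ) : EReal)) atTop) :
    (∀ φ : ℝ → ℝ, IsCadlagHistory φ → 0 < sInf (φ '' Icc (-1) 0) →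
      ∃ x : ℝ → ℝ, SolvesMackeyGlassIVP γ r p φ x ∧
        (∀ y : ℝ → ℝ, SolvesMackeyGlassIVP γ r p φ y → EqOn y x (Ici (-1))) ∧
        0 < sInf (x '' Ici 0)) ∧
    (∀ γ₀ r₀ : ℝ, (∀ t : ℝ, 0 ≤ t → γ t = γ₀) → (∀ t : ℝ, 0 ≤ t → r t = r₀) →
      γ₀ < r₀ ∧
      ∃ ν : Measure SegmentSpace, IsInvariantMeasure γ₀ r₀ p ν ∧ ν ≠ Measure.dirac 0 ∧
        IsStationaryDistribution γ₀ r₀ p (ν.map evalAtZero) ∧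
        ∃ m M : ℝ, 0 < m ∧ 0 < M ∧ (ν.map evalAtZero) (Icc m M) = 1) := by
  refine ⟨fun φ hφ hφ0 => existsUnique_persistent_solution hp hγ_pos hr_pos hγ_int hr_meas
    hr_bdd hlim hφ hφ0, fun γ₀ r₀ hγ₀ hr₀ => ?_⟩
  have hγ₀0 : 0 < γ₀ := hγ₀ 0 le_rfl ▸ hγ_pos 0 le_rfl
  have hlt : γ₀ < r₀ := by
    have h : (fun t : ℝ => ((r t / γ t : ℝ) : EReal)) =ᶠ[atTop]
        fun _ => ((r₀ / γ₀ : ℝ) : EReal) := by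
      filter_upwards [eventually_ge_atTop 0] with t ht
      rw [hγ₀ t ht, hr₀ t ht]
    rw [liminf_congr h, liminf_const] at hlim
    exact (one_lt_div hγ₀0).1 (by exact_mod_cast hlim)
  obtain ⟨e, he0, he⟩ := exists_pos_equilibrium hp hγ₀0 hlt
  have hmap : (Measure.dirac (ContinuousMap.const _ e : SegmentSpace)).map evalAtZero =
      Measure.dirac e := by
    rw [Measure.map_dirac' continuous_evalAtZero.measurable]
    rfl
  -- The stationary law is the point mass at `e`, so `m = M = e`.
  refine ⟨hlt, Measure.dirac (ContinuousMap.const _ e),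
    isInvariantMeasure_dirac_const hγ₀0.le he0.le he, fun h => ?_, ?_, e, e, he0, he0, ?_⟩
  · have h1 := congrArg (fun ν : Measure SegmentSpace => ν {0}) h
    have h2 : (ContinuousMap.const _ e : SegmentSpace) ≠ 0 := fun h3 =>
      he0.ne' (by simpa using DFunLike.congr_fun h3 ⟨0, by norm_num⟩)
    simp [h2] at h1
  · rw [hmap]
    exact isStationaryDistribution_dirac he0.le he
  · rw [hmap]
    simp
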